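/- Let $AP$ be a finite non-empty set of atomic propositions and $\Sigma$ a finite non-empty set of atomic programs. A trace is an infinite alternating sequence $A_0\sigma_0A_1\sigma_1\cdots$ with $A_j\subseteq AP$ and $\sigma_j\in\Sigma$. A linear HyperPDL-$\Delta$ formula is a closed formula $Q_1\pi_1\cdots Q_n\pi_n.\,\psi$ with $n\ge 1$, $Q_i\in\{\exists,\forall\}$ and $\psi$ generated by $$\psi ::= a_{\pi_i}\mid\lnot\psi\mid\psi\land\psi\mid\psi\lor\psi\mid\langle\alpha\rangle\psi\mid[\alpha]\psi\mid\Delta\alpha,\qquad \alpha ::= \tau\mid\varepsilon\mid\alpha+\alpha\mid\alpha\cdot\alpha\mid\alpha^*\mid\psi?$$ where $a\in AP$, $1\le i\le n$ and $\tau\in(\Sigma\cup\{\cdot\})^n$. For an assignment $\Pi$ of traces to $\pi_1,\dots,\pi_n$ let $\Pi[i,\infty]$ be the assignment in which every trace $A_0\sigma_0A_1\sigma_1\cdots$ is replaced by its suffix $A_i\sigma_iA_{i+1}\sigma_{i+1}\cdots$. Put $\Pi\models a_\pi$ iff $a$ belongs to the first label $A_0$ of $\Pi(\pi)$; interpret Boolean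 connectives as usual; $\Pi\models\langle\alpha\rangle\psi$ (resp. $[\alpha]\psi$) iff $\Pi[i,\infty]\models\psi$ for some (resp. every) $i\ge 0$ with $(\Pi,0,i)\in R(\alpha)$; $\Pi\models\Delta\alpha$ iff there are $0=k_1\le k_2\le\cdots$ with $(\Pi,k_j,k_{j+1})\in R(\alpha)$ for all $j\ge 1$. Here $(\Pi,i,k)\in R(\tau)$ iff $k=i+1$ and for each $l$ either $\tau_l=\cdot$ or $\tau_l$ is the program $\sigma_i$ of the trace $\Pi(\pi_l)$; $(\Pi,i,k)\in R(\psi?)$ iff $i=k$ and $\Pi[i,\infty]\models\psi$; $R(\varepsilon)$ is equality of positions, and $+$, $\cdot$, ${}^*$ are union, composition and reflexive transitive closure. For a set $T$ of traces, write $T\models Q_1\pi_1\cdots Q_n\pi_n.\,\psi$ if the formula holds with all quantifiers ranging over $T$. A linear formula is satisfiable if $T\models\varphi$ for some non-empty set $T$ of traces. Theorem. The satisfiability problem for linear HyperPDL-$\Delta$ is undecidable: there is no algorithm that, given (a finite-word encoding of) a linear HyperPDL-$\Delta$ formula $\varphi$ over $AP$ and $\Sigma$, decides whether $\varphi$ is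 satisfiable. -/

import Mathlib

namespace HyperPDL

/-! ### Syntax -/

mutual

/-- Quantifier-free HyperPDL-Δ formulas in the scope of `n` path quantifiers, over atomic
propositions `AP` and atomic programs `Sg`. The path variable bound by the outermost quantifier
has index `0`, the one bound by the innermost quantifier has index `n - 1`. -/
inductive Formula (AP Sg : Type) (n : ℕ) : Type
  | atom (a : AP) (i : Fin n) : Formula AP Sg n
  | neg (φ : Formula AP Sg n) : Formula AP Sg n
  | and (φ ψ : Formula AP Sg n) : Formula AP Sg n
  | or (φ ψ : Formula AP Sg n) : Formula AP Sg n
  | dia (α : Program AP Sg n) (φ : Formula AP Sg n) : Formula AP Sg n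
  | box (α : Program AP Sg n) (φ : Formula AP Sg n) : Formula AP Sg n
  | delta (α : Program AP Sg n) : Formula AP Sg n

/-- Programs in the scope of `n` path quantifiers. In a tuple `τ`, the value `none` is the
wildcard and `some σ` is the atomic program `σ`. -/
inductive Program (AP Sg : Type) (n : ℕ) : Type
  | tuple (τ : Fin n → Option Sg) : Program AP Sg n
  | eps : Program AP Sg n
  | union (α β : Program AP Sg n) : Program AP Sg n
  | seq (α β : Program AP Sg n) : Program AP Sg n
  | star (α : Program AP Sg n) : Program AP Sg n
  | test (φ : Formula AP Sg n) : Program AP Sg n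

end

/-- Formulas `Q π ⋯ Q π. ψ` with `ψ` quantifier-free, in the scope of `n` further quantifiers.
The quantifier-free part occurs in the scope of at least one quantifier. -/
inductive PrenexFormula (AP Sg : Type) : ℕ → Type
  | matrix {n : ℕ} (ψ : Formula AP Sg (n + 1)) : PrenexFormula AP Sg (n + 1)
  | ex {n : ℕ} (φ : PrenexFormula AP Sg (n + 1)) : PrenexFormula AP Sg n
  | all {n : ℕ} (φ : PrenexFormula AP Sg (n + 1)) : PrenexFormula AP Sg n

/-- Closed linear HyperPDL-Δ formulas `Q₁ π₁ ⋯ Qₙ πₙ. ψ`. -/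
abbrev LinearFormula (AP Sg : Type) : Type := PrenexFormula AP Sg 0

/-! ### Semantics -/

/-- Traces `A₀ σ₀ A₁ σ₁ ⋯` with `Aⱼ ⊆ AP` and `σⱼ ∈ Sg`. The value at `j` is the pair `(Aⱼ, σⱼ)`,
so position `j` here is the even position `2 * j` of the alternating sequence. -/
abbrev Trace (AP Sg : Type) : Type := ℕ → Set AP × Sg

/-- Trace assignments with domain of size `n`. -/
abbrev Assignment (AP Sg : Type) (n : ℕ) : Type := Fin n → Trace AP Sg

/-- The assignment `Π[i,∞]`: every trace is replaced by its suffix starting at position `i`. -/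
def Assignment.shift {AP Sg : Type} {n : ℕ} (P : Assignment AP Sg n) (i : ℕ) :
    Assignment AP Sg n :=
  fun l j => P l (i + j)

mutual

/-- `φ.Sat Π` is `Π ⊨ φ`. -/
def Formula.Sat {AP Sg : Type} {n : ℕ} : Formula AP Sg n → Assignment AP Sg n → Prop
  | .atom a i, P => a ∈ (P i 0).1
  | .neg φ, P => ¬ φ.Sat P
  | .and φ ψ, P => φ.Sat P ∧ ψ.Sat P
  | .or φ ψ, P => φ.Sat P ∨ ψ.Sat P
  | .dia α φ, P => ∃ i, φ.Sat (P.shift i) ∧ α.Rel P 0 i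
  | .box α φ, P => ∀ i, α.Rel P 0 i → φ.Sat (P.shift i)
  | .delta α, P => ∃ k : ℕ → ℕ, k 0 = 0 ∧ ∀ i, k i ≤ k (i + 1) ∧ α.Rel P (k i) (k (i + 1))

/-- `α.Rel Π i k` is `(Π, i, k) ∈ R(α)`. -/
def Program.Rel {AP Sg : Type} {n : ℕ} : Program AP Sg n → Assignment AP Sg n → ℕ → ℕ → Prop
  | .tuple τ, P, i, k => k = i + 1 ∧ ∀ l, τ l = none ∨ τ l = some (P l i).2
  | .eps, _, i, k => i = k
  | .union α β, P, i, k => α.Rel P i k ∨ β.Rel P i k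
  | .seq α β, P, i, k => ∃ j, i ≤ j ∧ j ≤ k ∧ α.Rel P i j ∧ β.Rel P j k
  | .star α, P, i, k => Relation.ReflTransGen (fun j j' => j ≤ j' ∧ α.Rel P j j') i k
  | .test φ, P, i, k => i = k ∧ φ.Sat (P.shift i)

end

/-- `φ.Sat T Π` is `Π ⊨ φ`, where quantifiers range over the set of traces `T`. -/
def PrenexFormula.Sat {AP Sg : Type} (T : Set (Trace AP Sg)) :
    {n : ℕ} → PrenexFormula AP Sg n → Assignment AP Sg n → Prop
  | _, .matrix ψ, P => ψ.Sat P
  | n, .ex φ, P => ∃ t ∈ T, φ.Sat T (Fin.snoc (α := fun _ : Fin (n + 1) => Trace AP Sg) P t)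
  | n, .all φ, P => ∀ t ∈ T, φ.Sat T (Fin.snoc (α := fun _ : Fin (n + 1) => Trace AP Sg) P t)

/-- `T ⊨ φ`: satisfaction under the assignment with empty domain. -/
def LinearFormula.Models {AP Sg : Type} (T : Set (Trace AP Sg)) (φ : LinearFormula AP Sg) : Prop :=
  PrenexFormula.Sat T φ (fun i => i.elim0)

/-- Satisfiability: `φ` holds in some nonempty set of traces. -/
def LinearFormula.Satisfiable {AP Sg : Type} (φ : LinearFormula AP Sg) : Prop :=
  ∃ T : Set (Trace AP Sg), T.Nonempty ∧ LinearFormula.Models T φ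

/-! ### Formulas as inputs of algorithms

A formula over `Fin m` and `Fin k` is presented to an algorithm as a word of natural numbers,
namely its syntax tree written in prefix notation. -/

mutual

/-- Prefix notation of a formula. -/
def Formula.code {m k n : ℕ} : Formula (Fin m) (Fin k) n → List ℕ
  | .atom a i => [0, a, i]
  | .neg φ => 1 :: φ.code
  | .and φ ψ => 2 :: (φ.code ++ ψ.code)
  | .or φ ψ => 3 :: (φ.code ++ ψ.code)
  | .dia α φ => 4 :: (α.code ++ φ.code)
  | .box α φ => 5 :: (α.code ++ φ.code)
  | .delta α => 6 :: α.code

/-- Prefix notation of a program; in a tuple, the wildcard is written as `0` and the atomic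
program `σ` as `σ + 1`. -/
def Program.code {m k n : ℕ} : Program (Fin m) (Fin k) n → List ℕ
  | .tuple τ => 7 :: List.ofFn (fun l => (τ l).elim 0 (fun s => (s : ℕ) + 1))
  | .eps => [8]
  | .union α β => 9 :: (α.code ++ β.code)
  | .seq α β => 10 :: (α.code ++ β.code)
  | .star α => 11 :: α.code
  | .test φ => 12 :: φ.code

end

/-- Prefix notation of a formula with a quantifier prefix. -/
def PrenexFormula.code {m k : ℕ} : {n : ℕ} → PrenexFormula (Fin m) (Fin k) n → List ℕ
  | _, .matrix ψ => ψ.code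
  | _, .ex φ => 13 :: φ.code
  | _, .all φ => 14 :: φ.code

/-! The prefix notation determines the formula. -/

mutual

theorem Formula.code_append_inj {m k n : ℕ} : ∀ (φ ψ : Formula (Fin m) (Fin k) n) (r s : List ℕ),
    φ.code ++ r = ψ.code ++ s → φ = ψ ∧ r = s
  | .atom a i, ψ, r, s, h => by
    cases ψ <;> simp [Formula.code, ← Fin.ext_iff] at h ⊢
    tauto
  | .neg φ, ψ, r, s, h => by
    cases ψ <;> simp [Formula.code] at h ⊢
    exact Formula.code_append_inj φ _ r s h
  | .and φ φ', ψ, r, s, h => by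
    cases ψ <;> simp [Formula.code] at h ⊢
    obtain ⟨h1, h2⟩ := Formula.code_append_inj φ _ _ _ h
    obtain ⟨h3, h4⟩ := Formula.code_append_inj φ' _ _ _ h2
    exact ⟨⟨h1, h3⟩, h4⟩
  | .or φ φ', ψ, r, s, h => by
    cases ψ <;> simp [Formula.code] at h ⊢
    obtain ⟨h1, h2⟩ := Formula.code_append_inj φ _ _ _ h
    obtain ⟨h3, h4⟩ := Formula.code_append_inj φ' _ _ _ h2
    exact ⟨⟨h1, h3⟩, h4⟩
  | .dia α φ, ψ, r, s, h => by
    cases ψ <;> simp [Formula.code] at h ⊢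
    obtain ⟨h1, h2⟩ := Program.code_append_inj α _ _ _ h
    obtain ⟨h3, h4⟩ := Formula.code_append_inj φ _ _ _ h2
    exact ⟨⟨h1, h3⟩, h4⟩
  | .box α φ, ψ, r, s, h => by
    cases ψ <;> simp [Formula.code] at h ⊢
    obtain ⟨h1, h2⟩ := Program.code_append_inj α _ _ _ h
    obtain ⟨h3, h4⟩ := Formula.code_append_inj φ _ _ _ h2
    exact ⟨⟨h1, h3⟩, h4⟩
  | .delta α, ψ, r, s, h => by
    cases ψ <;> simp [Formula.code] at h ⊢
    exact Program.code_append_inj α _ r s h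

theorem Program.code_append_inj {m k n : ℕ} : ∀ (α β : Program (Fin m) (Fin k) n) (r s : List ℕ),
    α.code ++ r = β.code ++ s → α = β ∧ r = s
  | .tuple τ, β, r, s, h => by
    cases β <;> simp [Program.code] at h ⊢
    obtain ⟨h1, h2⟩ := List.append_inj h (by simp)
    refine ⟨?_, h2⟩
    funext l
    have h3 := congrFun (List.ofFn_injective h1) l
    revert h3
    rename_i τ'
    cases τ l <;> cases τ' l <;> simp [Fin.ext_iff]
  | .eps, β, r, s, h => by
    cases β <;> simp [Program.code] at h ⊢
    exact h
  | .union α α', β, r, s, h => by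
    cases β <;> simp [Program.code] at h ⊢
    obtain ⟨h1, h2⟩ := Program.code_append_inj α _ _ _ h
    obtain ⟨h3, h4⟩ := Program.code_append_inj α' _ _ _ h2
    exact ⟨⟨h1, h3⟩, h4⟩
  | .seq α α', β, r, s, h => by
    cases β <;> simp [Program.code] at h ⊢
    obtain ⟨h1, h2⟩ := Program.code_append_inj α _ _ _ h
    obtain ⟨h3, h4⟩ := Program.code_append_inj α' _ _ _ h2
    exact ⟨⟨h1, h3⟩, h4⟩
  | .star α, β, r, s, h => by
    cases β <;> simp [Program.code] at h ⊢
    exact Program.code_append_inj α _ r s h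
  | .test φ, β, r, s, h => by
    cases β <;> simp [Program.code] at h ⊢
    exact Formula.code_append_inj φ _ r s h

end

theorem PrenexFormula.code_injective {m k : ℕ} : ∀ {n : ℕ},
    Function.Injective (PrenexFormula.code (m := m) (k := k) (n := n)) := by
  intro n φ
  induction φ with
  | matrix ψ =>
    intro χ h
    cases χ with
    | matrix ψ' => rw [(Formula.code_append_inj ψ ψ' [] [] (by simpa [code] using h)).1]
    | ex χ => cases ψ <;> simp [code, Formula.code] at h
    | all χ => cases ψ <;> simp [code, Formula.code] at h
  | ex φ ih =>
    intro χ h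
    cases χ with
    | matrix ψ' => cases ψ' <;> simp [code, Formula.code] at h
    | ex χ => rw [ih (by simpa [code] using h)]
    | all χ => simp [code] at h
  | all φ ih =>
    intro χ h
    cases χ with
    | matrix ψ' => cases ψ' <;> simp [code, Formula.code] at h
    | ex χ => simp [code] at h
    | all χ => rw [ih (by simpa [code] using h)]

end HyperPDL

namespace HyperPDL

-- Derived programs and connectives.

variable {AP Sg : Type} {n : ℕ}

-- Halting is reduced to unsatisfiability. Let `∃π₀ ∀π₁ ∃π₂` say that `π₀` describes the initial
-- configuration of a stack machine and that `π₂` describes a successor of whatever `π₁` describes.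
-- Any model then forces an infinite run, and conversely the descriptions of the configurations
-- reachable in an infinite run form a model (`satisfiable_runFormula`).
--
-- One proposition suffices: a trace is read as a set of positions, split by residue into a track
-- for the control state and one for each pair of a stack and a possible cell content. The blank
-- content has its own track, so the step condition consists of implications between positive marks,
-- and superfluous marks do no harm (`StepRel.describes`, `stepRel_description`).
--
-- Computability of the reduction is obtained by fixing one universal program and feeding it `2 ^
-- j`. In binary this is `j` zeros and a one, so the encoded formula depends on `j` only through the
-- number of repetitions of a fixed block (`computable_code_wordFormula`); everything chosen
-- noncomputably is constant.

theorem Assignment.shift_shift (P : Assignment AP Sg n) (i j : ℕ) :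
    (P.shift i).shift j = P.shift (i + j) := by
  funext l p
  simp [Assignment.shift, add_assoc]

theorem Assignment.shift_zero (P : Assignment AP Sg n) : P.shift 0 = P := by
  funext l p
  simp [Assignment.shift]

/-- The program that advances by `r` positions. -/
def Program.skip : ℕ → Program AP Sg n
  | 0 => .eps
  | r + 1 => .seq (.tuple fun _ => none) (Program.skip r)

theorem Program.rel_skip (P : Assignment AP Sg n) (r i k : ℕ) :
    (Program.skip r : Program AP Sg n).Rel P i k ↔ k = i + r := by
  induction r generalizing i with
  | zero => simp [Program.skip, Program.Rel, eq_comm]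
  | succ r ih =>
    simp only [Program.skip, Program.Rel, ih]
    constructor
    · rintro ⟨j, -, -, ⟨rfl, -⟩, rfl⟩
      omega
    · rintro rfl
      exact ⟨i + 1, by omega, by omega, ⟨rfl, by simp⟩, by omega⟩

theorem Program.rel_star_skip (P : Assignment AP Sg n) (B i k : ℕ) :
    (Program.star (Program.skip B) : Program AP Sg n).Rel P i k ↔ ∃ j, k = i + B * j := by
  simp only [Program.Rel, Program.rel_skip]
  constructor
  · intro h
    induction h with
    | refl => exact ⟨0, by simp⟩
    | tail _ h ih =>
      obtain ⟨j, rfl⟩ := ih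
      exact ⟨j + 1, by rw [h.2]; ring⟩
  · rintro ⟨j, rfl⟩
    induction j with
    | zero => exact .refl
    | succ j ih => exact ih.tail ⟨by gcongr; omega, by ring⟩

namespace Formula

/-- `φ` holds `r` positions later. -/
def later (r : ℕ) (φ : Formula AP Sg n) : Formula AP Sg n := .dia (.skip r) φ

/-- `φ` holds at every multiple of `B`. -/
def always (B : ℕ) (φ : Formula AP Sg n) : Formula AP Sg n := .box (.star (.skip B)) φ

/-- Implication. -/
def imp (φ ψ : Formula AP Sg n) : Formula AP Sg n := .or (.neg φ) ψ

/-- The conjunction of a list of formulas. -/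
def conj : List (Formula AP Sg n) → Formula AP Sg n
  | [] => .delta .eps
  | φ :: l => .and φ (conj l)

/-- The conjunction of a finite family of formulas. -/
noncomputable def forAll {ι : Type*} [Fintype ι] (f : ι → Formula AP Sg n) : Formula AP Sg n :=
  conj (Finset.univ.toList.map f)

theorem sat_later (r : ℕ) (φ : Formula AP Sg n) (P : Assignment AP Sg n) :
    (later r φ).Sat P ↔ φ.Sat (P.shift r) := by
  simp [later, Formula.Sat, Program.rel_skip]

theorem sat_always (B : ℕ) (φ : Formula AP Sg n) (P : Assignment AP Sg n) :
    (always B φ).Sat P ↔ ∀ j, φ.Sat (P.shift (B * j)) := by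
  simp [always, Formula.Sat, Program.rel_star_skip]

theorem sat_imp (φ ψ : Formula AP Sg n) (P : Assignment AP Sg n) :
    (imp φ ψ).Sat P ↔ (φ.Sat P → ψ.Sat P) := by
  simp [imp, Formula.Sat, imp_iff_not_or]

theorem sat_conj (l : List (Formula AP Sg n)) (P : Assignment AP Sg n) :
    (conj l).Sat P ↔ ∀ φ ∈ l, φ.Sat P := by
  induction l with
  -- `Δε` serves as the constant true: the sequence staying at position 0 witnesses it.
  | nil => simpa [conj, Formula.Sat, Program.Rel] using ⟨fun _ => 0, rfl, fun _ => ⟨le_rfl, rfl⟩⟩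
  | cons φ l ih => simp [conj, Formula.Sat, ih]

theorem sat_forAll {ι : Type*} [Fintype ι] (f : ι → Formula AP Sg n) (P : Assignment AP Sg n) :
    (forAll f).Sat P ↔ ∀ i, (f i).Sat P := by
  simp [forAll, sat_conj]

end Formula

-- Traces as sets of positions.

/-- The positions of a trace at which the proposition `a` holds. -/
def Trace.bits (a : AP) (t : Trace AP Sg) : Set ℕ := {p | a ∈ (t p).1}

theorem Trace.exists_bits_eq (a : AP) (σ : Sg) (s : Set ℕ) :
    ∃ t : Trace AP Sg, t.bits a = s :=
  ⟨fun p => ({_b | p ∈ s}, σ), rfl⟩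

theorem Trace.mem_bits_shift (a : AP) (P : Assignment AP Sg n) (q r : ℕ) (i : Fin n) :
    r ∈ Trace.bits a (P.shift q i) ↔ q + r ∈ (P i).bits a := Iff.rfl

theorem Formula.sat_later_atom (a : AP) (i : Fin n) (r : ℕ) (P : Assignment AP Sg n) :
    (Formula.later r (.atom a i)).Sat P ↔ r ∈ (P i).bits a := by
  simp [Formula.sat_later, Formula.Sat, Assignment.shift, Trace.bits]

-- Stack machines.

/-- An operation on a single stack. -/
inductive StackOp (Γ : Type*)
  | keep
  | pop
  | push (a : Γ)

namespace StackOp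

variable {Γ : Type*}

/-- The effect of an operation on the contents of a stack. -/
def act : StackOp Γ → List Γ → List Γ
  | keep, l => l
  | pop, l => l.tail
  | push a, l => a :: l

/-- The number of cells an operation removes. -/
def removed : StackOp Γ → ℕ
  | pop => 1
  | _ => 0

/-- The symbol an operation pushes. -/
def pushed : StackOp Γ → Option Γ
  | push a => some a
  | _ => none

/-- The number of cells an operation adds. -/
def added (op : StackOp Γ) : ℕ := op.pushed.elim 0 fun _ => 1

/-- The surviving cells only move by a constant offset. Cells past the end read `none`, so popping
an empty stack needs no special case. -/
theorem getElem?_act (op : StackOp Γ) (l : List Γ) (j : ℕ) :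
    (op.act l)[op.added + j]? = l[op.removed + j]? := by
  cases op <;> simp [act, added, pushed, removed, add_comm]

theorem getElem?_act_lt (op : StackOp Γ) (l : List Γ) (j : ℕ) (h : j < op.added) :
    j = 0 ∧ (op.act l)[j]? = op.pushed := by
  cases op <;> simp [act, added, pushed] at h ⊢
  simp [h]

theorem getElem?_act_zero {op : StackOp Γ} {a : Γ} (h : op.pushed = some a) (l : List Γ) :
    (op.act l)[0]? = some a := by
  cases op <;> simp [act, pushed] at h ⊢
  exact h

end StackOp

/-- An instruction acts on every stack and selects the next control state according to the top
symbol of the stack `tested`. -/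
structure StackInstr (Q K Γ : Type*) where
  tested : K
  next : Option Γ → Q
  op : K → StackOp Γ

/-- A machine with control states `Q`, stacks `K` and stack alphabet `Γ`; it halts in the control
states without instruction. -/
abbrev StackMachine (Q K Γ : Type*) := Q → Option (StackInstr Q K Γ)

/-- The effect of an instruction. -/
def StackInstr.exec {Q K Γ : Type*} (i : StackInstr Q K Γ) (S : K → List Γ) : Q × (K → List Γ) :=
  (i.next (S i.tested).head?, fun k => (i.op k).act (S k))

/-- The transition function of a machine. -/
def StackMachine.step {Q K Γ : Type*} (M : StackMachine Q K Γ) (c : Q × (K → List Γ)) :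
    Option (Q × (K → List Γ)) :=
  (M c.1).map fun i => i.exec c.2

namespace StackMachine

-- Configurations as sets of positions.

section Layout

variable {Q K Γ : Type} [Fintype K] [Fintype Γ]

variable (K Γ) in
/-- The number of tracks interleaved in a trace: one for the control state and one for every stack
and every possible content of a cell. -/
noncomputable def tracks : ℕ := Fintype.card (Option (K × Option Γ))

/-- The position of cell `j` on a track. -/
noncomputable def pos (x : Option (K × Option Γ)) (j : ℕ) : ℕ :=
  tracks K Γ * j + (Fintype.equivFin _ x : ℕ)

/-- Moving by multiples of `tracks K Γ` stays on the same track, so `always (tracks K Γ)` quantifies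
over cell indices. -/
theorem pos_add (x : Option (K × Option Γ)) (i j : ℕ) :
    tracks K Γ * j + pos x i = pos x (i + j) := by
  simp only [pos]
  ring

theorem pos_inj {x y : Option (K × Option Γ)} {i j : ℕ} : pos x i = pos y j ↔ x = y ∧ i = j := by
  refine ⟨fun h => ?_, by rintro ⟨rfl, rfl⟩; rfl⟩
  have hx : (Fintype.equivFin _ x : ℕ) < tracks K Γ := (Fintype.equivFin _ x).2
  have hy : (Fintype.equivFin _ y : ℕ) < tracks K Γ := (Fintype.equivFin _ y).2
  have h0 : 0 < tracks K Γ := by omega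
  unfold pos at h
  have h1 := congrArg (· % tracks K Γ) h
  have h2 := congrArg (· / tracks K Γ) h
  simp only [Nat.mul_add_mod, Nat.mod_eq_of_lt hx, Nat.mod_eq_of_lt hy] at h1
  simp only [Nat.mul_add_div h0, Nat.div_eq_of_lt hx, Nat.div_eq_of_lt hy, add_zero] at h2
  exact ⟨(Fintype.equivFin _).injective (Fin.ext h1), h2⟩

variable (K Γ) in
open Classical in
/-- The position marking the control state `q`, where `L` enumerates the control states. -/
noncomputable def ctrl (L : List Q) (q : Q) : ℕ := pos (none : Option (K × Option Γ)) (L.idxOf q)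

/-- The position expressing that cell `j` of stack `k` has content `o`. -/
noncomputable def cell (k : K) (o : Option Γ) (j : ℕ) : ℕ := pos (some (k, o)) j

/-- The positions in `s` include those describing the configuration `c`. -/
def Describes (L : List Q) (s : Set ℕ) (c : Q × (K → List Γ)) : Prop :=
  ctrl K Γ L c.1 ∈ s ∧ ∀ k j, cell k (c.2 k)[j]? j ∈ s

/-- The positions describing a configuration. -/
def description (L : List Q) (c : Q × (K → List Γ)) : Set ℕ :=
  {p | p = ctrl K Γ L c.1 ∨ ∃ k j, p = cell k (c.2 k)[j]? j}

theorem describes_description (L : List Q) (c : Q × (K → List Γ)) :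
    Describes L (description L c) c :=
  ⟨Or.inl rfl, fun k j => Or.inr ⟨k, j, rfl⟩⟩

/-- Membership in `L` matters because `idxOf` sends all states outside `L` to the same index. -/
theorem ctrl_mem_description {L : List Q} {c : Q × (K → List Γ)} {q : Q} (hq : q ∈ L) :
    ctrl K Γ L q ∈ description L c ↔ q = c.1 := by
  simp only [description, ctrl, cell, Set.mem_ofPred_eq, pos_inj, true_and, reduceCtorEq, false_and,
    exists_false, or_false]
  classical
  exact ⟨fun h => (List.idxOf_inj hq).1 h, by rintro rfl; rfl⟩

theorem cell_mem_description {L : List Q} {c : Q × (K → List Γ)} {k : K} {o : Option Γ} {j : ℕ} :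
    cell k o j ∈ description L c ↔ o = (c.2 k)[j]? := by
  simp only [description, ctrl, cell, Set.mem_ofPred_eq, pos_inj, reduceCtorEq, false_and,
    false_or, Option.some.injEq, Prod.mk.injEq]
  exact ⟨by rintro ⟨k', j', ⟨rfl, rfl⟩, rfl⟩; rfl, by rintro rfl; exact ⟨_, _, ⟨rfl, rfl⟩, rfl⟩⟩

/-- The conditions on the positions `s` and `s'` that make `s'` describe the result of executing
`i` whenever `s` describes the configuration before. -/
def ExecRel (L : List Q) (i : StackInstr Q K Γ) (s s' : Set ℕ) : Prop :=
  (∀ o : Option Γ, cell i.tested o 0 ∈ s → ctrl K Γ L (i.next o) ∈ s') ∧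
  (∀ (k : K) (o : Option Γ) j, cell k o ((i.op k).removed + j) ∈ s → cell k o ((i.op k).added + j) ∈ s') ∧
  ∀ (k : K) (a : Γ), (i.op k).pushed = some a → cell k (some a) 0 ∈ s'

/-- The conditions on `s` and `s'` for all the control states in `L`. -/
def StepRel (M : StackMachine Q K Γ) (L : List Q) (s s' : Set ℕ) : Prop :=
  ∀ q ∈ L, ctrl K Γ L q ∈ s → ∃ i, M q = some i ∧ ExecRel L i s s'

/-- The marks demanded by the new configuration are pushed symbols or shifted old marks, blanks
included; nothing has to be absent. -/
theorem ExecRel.describes {L : List Q} {i : StackInstr Q K Γ} {s s' : Set ℕ} (h : ExecRel L i s s')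
    {q : Q} {S : K → List Γ} (hs : Describes L s (q, S)) : Describes L s' (i.exec S) := by
  refine ⟨h.1 _ ?_, fun k j => ?_⟩
  · simpa [List.head?_eq_getElem?] using hs.2 i.tested 0
  · simp only [StackInstr.exec]
    rcases lt_or_ge j (i.op k).added with hj | hj
    · obtain ⟨rfl, hj'⟩ := (i.op k).getElem?_act_lt (S k) j hj
      rw [hj']
      cases hp : (i.op k).pushed with
      | none => simp [StackOp.added, hp] at hj
      | some a => exact h.2.2 k a hp
    · obtain ⟨j, rfl⟩ := Nat.exists_eq_add_of_le hj
      rw [StackOp.getElem?_act]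
      exact h.2.1 k _ j (hs.2 k _)

/-- An exact description has no superfluous marks, so each implication is triggered only by the true
contents. -/
theorem execRel_description (L : List Q) (i : StackInstr Q K Γ) (q : Q) (S : K → List Γ) :
    ExecRel L i (description L (q, S)) (description L (i.exec S)) := by
  refine ⟨fun o ho => ?_, fun k o j ho => ?_, fun k a h => ?_⟩
  · rw [cell_mem_description] at ho
    subst ho
    rw [← List.head?_eq_getElem?]
    exact (describes_description L (i.exec S)).1
  · rw [cell_mem_description] at ho ⊢
    rw [ho]
    exact (StackOp.getElem?_act _ _ _).symm
  · rw [cell_mem_description]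
    exact (StackOp.getElem?_act_zero h _).symm

theorem StepRel.describes {M : StackMachine Q K Γ} {L : List Q} {s s' : Set ℕ}
    (h : StepRel M L s s') {c : Q × (K → List Γ)} (hL : c.1 ∈ L) (hs : Describes L s c) :
    ∃ c', M.step c = some c' ∧ Describes L s' c' := by
  obtain ⟨i, hi, hr⟩ := h _ hL hs.1
  exact ⟨_, by simp [step, hi], hr.describes hs⟩

theorem stepRel_description {M : StackMachine Q K Γ} {L : List Q} {c c' : Q × (K → List Γ)}
    (h : M.step c = some c') : StepRel M L (description L c) (description L c') := by
  intro q hq hm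
  rw [ctrl_mem_description hq] at hm
  subst hm
  obtain ⟨i, hi, rfl⟩ := Option.map_eq_some_iff.1 h
  exact ⟨i, hi, execRel_description L i _ _⟩

end Layout

-- Machine runs as formulas.

section Formulas

open Formula

variable {AP Sg Q K Γ : Type} [Fintype K] [Fintype Γ] {n : ℕ}

/-- A formula for `ExecRel`, with the positions read from the traces `l` and `l'`. -/
noncomputable def execFormula (a : AP) (l l' : Fin n) (L : List Q) (i : StackInstr Q K Γ) :
    Formula AP Sg n :=
  .and
    (forAll fun o : Option Γ => imp (later (cell i.tested o 0) (.atom a l))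
      (later (ctrl K Γ L (i.next o)) (.atom a l')))
    (.and
      (forAll fun k : K => forAll fun o : Option Γ => always (tracks K Γ)
        (imp (later (cell k o (i.op k).removed) (.atom a l))
          (later (cell k o (i.op k).added) (.atom a l'))))
      (forAll fun k : K => conj ((i.op k).pushed.toList.map fun b : Γ =>
        later (cell k (some b) 0) (.atom a l'))))

theorem sat_execFormula (a : AP) (l l' : Fin n) (L : List Q) (i : StackInstr Q K Γ)
    (P : Assignment AP Sg n) :
    (execFormula a l l' L i).Sat P ↔ ExecRel L i ((P l).bits a) ((P l').bits a) := by
  simp [execFormula, ExecRel, Formula.Sat, sat_forAll, sat_imp, sat_later_atom, sat_always,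
    Trace.mem_bits_shift, sat_conj, cell, pos_add]

/-- A formula for `StepRel`. -/
noncomputable def stepFormula (a : AP) (l l' : Fin n) (L : List Q) (M : StackMachine Q K Γ) :
    Formula AP Sg n :=
  conj (L.map fun q => imp (later (ctrl K Γ L q) (.atom a l))
    ((M q).elim (.neg (conj [])) (execFormula a l l' L)))

theorem sat_stepFormula (a : AP) (l l' : Fin n) (L : List Q) (M : StackMachine Q K Γ)
    (P : Assignment AP Sg n) :
    (stepFormula a l l' L M).Sat P ↔ StepRel M L ((P l).bits a) ((P l').bits a) := by
  simp only [stepFormula, StepRel, sat_conj, List.forall_mem_map, sat_imp, sat_later_atom]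
  refine forall₃_congr fun q _ _ => ?_
  cases M q <;> simp [sat_execFormula, Formula.Sat, sat_conj]

/-- Stack `k` has the content `w`. -/
noncomputable def wordFormula (a : AP) (l : Fin n) (k : K) : List Γ → Formula AP Sg n
  | [] => always (tracks K Γ) (later (cell k (none : Option Γ) 0) (.atom a l))
  | b :: w => .and (later (cell k (some b) 0) (.atom a l)) (later (tracks K Γ) (wordFormula a l k w))

/-- The offset `i` is for the induction: each letter moves the evaluation point on by one cell. -/
theorem sat_wordFormula (a : AP) (l : Fin n) (k : K) (w : List Γ) (P : Assignment AP Sg n) (i : ℕ) :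
    (wordFormula a l k w).Sat (P.shift (tracks K Γ * i)) ↔
      ∀ j, cell k w[j]? (i + j) ∈ (P l).bits a := by
  induction w generalizing i with
  | nil =>
    simp only [wordFormula, sat_always, sat_later_atom, Trace.mem_bits_shift, Assignment.shift_shift, ← mul_add, cell,
      pos_add]
    simp
  | cons b w ih =>
    have h := ih (i + 1)
    rw [mul_add_one] at h
    simp only [wordFormula, Formula.Sat, sat_later_atom, Trace.mem_bits_shift]
    rw [sat_later, Assignment.shift_shift, h]
    simp only [cell, pos_add]
    constructor
    · rintro ⟨h1, h2⟩ (_ | j)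
      · simpa using h1
      · simpa [add_assoc, add_comm 1 j] using h2 j
    · intro h
      exact ⟨by simpa using h 0, fun j => by simpa [add_assoc, add_comm 1 j] using h (j + 1)⟩

/-- The control state is `q`, stack `k` has the content `w` and the other stacks are empty. -/
noncomputable def initFormula [DecidableEq K] (a : AP) (l : Fin n) (L : List Q) (q : Q) (k : K)
    (w : List Γ) : Formula AP Sg n :=
  .and (wordFormula a l k w) (.and (later (ctrl K Γ L q) (.atom a l))
    (conj ((Finset.univ.erase k).toList.map fun k' => wordFormula a l k' ([] : List Γ))))

theorem sat_initFormula [DecidableEq K] (a : AP) (l : Fin n) (L : List Q) (q : Q) (k : K)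
    (w : List Γ) (P : Assignment AP Sg n) :
    (initFormula a l L q k w).Sat P ↔
      Describes L ((P l).bits a) (q, Function.update (fun _ => []) k w) := by
  have h (k : K) (w : List Γ) : (wordFormula a l k w).Sat P ↔ ∀ j, cell k w[j]? j ∈ (P l).bits a :=
    by simpa [Assignment.shift_zero] using sat_wordFormula a l k w P 0
  simp only [initFormula, Formula.Sat, h, sat_later_atom, sat_conj, List.forall_mem_map,
    Finset.mem_toList, Finset.mem_erase, Finset.mem_univ, and_true, Describes]
  constructor
  · rintro ⟨h1, h2, h3⟩
    refine ⟨h2, fun k' => ?_⟩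
    by_cases hk : k' = k
    · subst hk
      simpa using h1
    · simpa [hk] using h3 k' hk
  · rintro ⟨h1, h2⟩
    exact ⟨by simpa using h2 k, h1, fun k' hk => by simpa [hk] using h2 k'⟩

/-- The formula `∃ π₀. ∀ π₁. ∃ π₂. ψ` expressing that the machine has an infinite run. -/
noncomputable def runFormula [DecidableEq K] (a : AP) (M : StackMachine Q K Γ) (L : List Q) (q : Q)
    (k : K) (w : List Γ) : LinearFormula AP Sg :=
  .ex (.all (.ex (.matrix (.and (initFormula a 0 L q k w) (stepFormula a 1 2 L M)))))

theorem models_runFormula [DecidableEq K] (a : AP) (M : StackMachine Q K Γ) (L : List Q) (q : Q)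
    (k : K) (w : List Γ) (T : Set (Trace AP Sg)) :
    LinearFormula.Models T (runFormula a M L q k w) ↔
      ∃ t₀ ∈ T, ∀ t ∈ T, ∃ t' ∈ T,
        Describes L (t₀.bits a) (q, Function.update (fun _ => []) k w) ∧
          StepRel M L (t.bits a) (t'.bits a) := by
  simp only [LinearFormula.Models, runFormula, PrenexFormula.Sat, Formula.Sat, sat_initFormula,
    sat_stepFormula]
  rfl

theorem satisfiable_runFormula [DecidableEq K] [Nonempty Sg] (a : AP) (M : StackMachine Q K Γ)
    (L : List Q) (hL : ∀ q ∈ L, ∀ i, M q = some i → ∀ o, i.next o ∈ L) (q : Q) (hq : q ∈ L)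
    (k : K) (w : List Γ) :
    (runFormula a M L q k w : LinearFormula AP Sg).Satisfiable ↔
      ¬ (StateTransition.eval M.step (q, Function.update (fun _ => []) k w)).Dom := by
  set c₀ : Q × (K → List Γ) := (q, Function.update (fun _ => []) k w) with hc₀
  simp only [LinearFormula.Satisfiable, models_runFormula]
  rw [Part.dom_iff_mem]
  simp only [StateTransition.mem_eval, not_exists, not_and]
  constructor
  · rintro ⟨T, -, t₀, ht₀, h⟩ c hr
    -- Along the run, every reachable configuration is described by some trace of `T`; the step
    -- condition at that trace then excludes halting.
    have key : c.1 ∈ L ∧ ∃ t ∈ T, Describes L (t.bits a) c := by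
      induction hr with
      | refl =>
        -- The initial condition sits below the inner quantifiers, so these must be instantiated to
        -- reach it.
        obtain ⟨-, -, h1, -⟩ := h t₀ ht₀
        exact ⟨hq, t₀, ht₀, h1⟩
      | tail _ hs ih =>
        obtain ⟨hc, t, ht, hd⟩ := ih
        obtain ⟨t', ht', -, h1⟩ := h t ht
        obtain ⟨c', hc', hd'⟩ := h1.describes hc hd
        cases Option.mem_unique hs hc'
        obtain ⟨i, hi, rfl⟩ := Option.map_eq_some_iff.1 hc'
        exact ⟨hL _ hc i hi _, t', ht', hd'⟩
    obtain ⟨hc, t, ht, hd⟩ := key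
    obtain ⟨t', ht', -, h1⟩ := h t ht
    obtain ⟨c', hc', -⟩ := h1.describes hc hd
    simp [hc']
  · intro h
    have σ : Sg := Classical.arbitrary Sg
    obtain ⟨t₀, ht₀⟩ := Trace.exists_bits_eq a σ (description L c₀)
    -- The model: all exact descriptions of reachable configurations.
    have hm : t₀ ∈ {t : Trace AP Sg | ∃ c, StateTransition.Reaches M.step c₀ c ∧
        t.bits a = description L c} := ⟨c₀, .refl, ht₀⟩
    refine ⟨_, ⟨t₀, hm⟩, t₀, hm, ?_⟩
    rintro t ⟨c, hc, ht⟩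
    obtain ⟨c', hc'⟩ := Option.ne_none_iff_exists'.1 (h c hc)
    obtain ⟨t', ht'⟩ := Trace.exists_bits_eq a σ (description L c')
    refine ⟨t', ⟨c', hc.tail hc', ht'⟩, ?_, ?_⟩
    · rw [ht₀]
      exact describes_description L c₀
    · rw [ht, ht']
      exact stepRel_description hc'

end Formulas

end StackMachine

-- `TM2` programs as stack machines.

open Turing

namespace StackMachine

variable {K Γ Λ σ : Type}

/-- An enumeration of the control states of `ofTM2 M` used from the labels in `S`. -/
noncomputable def tm2States [Fintype σ] (M : Λ → TM2.Stmt (fun _ : K => Γ) Λ σ) (S : Finset Λ) :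
    List (Option (TM2.Stmt (fun _ : K => Γ) Λ σ) × σ) :=
  (TM2.stmts M S ×ˢ Finset.univ).toList

theorem mem_tm2States [Fintype σ] {M : Λ → TM2.Stmt (fun _ : K => Γ) Λ σ} {S : Finset Λ}
    {q : Option (TM2.Stmt (fun _ : K => Γ) Λ σ)} {v : σ} :
    (q, v) ∈ tm2States M S ↔ q ∈ TM2.stmts M S := by
  simp [tm2States]

theorem some_apply_mem_stmts (M : Λ → TM2.Stmt (fun _ : K => Γ) Λ σ) {S : Finset Λ} {l : Λ}
    (hl : l ∈ S) : some (M l) ∈ TM2.stmts M S := by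
  simp only [TM2.stmts, Finset.mem_insertNone, Finset.mem_biUnion, Option.mem_def,
    Option.some.injEq, forall_eq']
  exact ⟨l, hl, TM2.stmts₁_self⟩

variable [DecidableEq K]

theorem act_update (S : K → List Γ) (k : K) (op : StackOp Γ) :
    (fun k' => (Function.update (fun _ => StackOp.keep) k op k').act (S k')) =
      Function.update S k (op.act (S k)) := by
  funext k'
  by_cases h : k' = k
  · subst h
    simp
  · simp [h, StackOp.act]

variable [Inhabited K]

/-- The machine that executes the statements of a `TM2` program one at a time. Its control states
consist of the remaining statement, or `none` after halting, and the local variables. -/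
def ofTM2 (M : Λ → TM2.Stmt (fun _ : K => Γ) Λ σ) :
    StackMachine (Option (TM2.Stmt (fun _ : K => Γ) Λ σ) × σ) K Γ
  | (none, _) => none
  | (some (.push k f q), v) =>
    some ⟨default, fun _ => (some q, v), Function.update (fun _ => StackOp.keep) k (.push (f v))⟩
  | (some (.peek k f q), v) => some ⟨k, fun o => (some q, f v o), fun _ => .keep⟩
  | (some (.pop k f q), v) =>
    some ⟨k, fun o => (some q, f v o), Function.update (fun _ => StackOp.keep) k .pop⟩
  | (some (.load f q), v) => some ⟨default, fun _ => (some q, f v), fun _ => .keep⟩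
  | (some (.branch f q₁ q₂), v) =>
    some ⟨default, fun _ => (some (cond (f v) q₁ q₂), v), fun _ => .keep⟩
  | (some (.goto f), v) => some ⟨default, fun _ => (some (M (f v)), v), fun _ => .keep⟩
  | (some .halt, v) => some ⟨default, fun _ => (none, v), fun _ => .keep⟩

/-- The configuration of `ofTM2 M` corresponding to a configuration of `M`. -/
def ofTM2Cfg (M : Λ → TM2.Stmt (fun _ : K => Γ) Λ σ) (c : TM2.Cfg (fun _ : K => Γ) Λ σ) :
    (Option (TM2.Stmt (fun _ : K => Γ) Λ σ) × σ) × (K → List Γ) :=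
  ((c.l.map M, c.var), c.stk)

/-- One `TM2` step runs a whole statement, here split into its primitive commands. At least one is
executed, so the simulation preserves divergence. -/
theorem reaches₁_stepAux (M : Λ → TM2.Stmt (fun _ : K => Γ) Λ σ)
    (q : TM2.Stmt (fun _ : K => Γ) Λ σ) (v : σ) (S : K → List Γ) :
    StateTransition.Reaches₁ (ofTM2 M).step ((some q, v), S) (ofTM2Cfg M (TM2.stepAux q v S)) := by
  induction q generalizing v S with
  | push k f q ih =>
    exact Relation.TransGen.head
      (by simp only [step, ofTM2, Option.map_some, StackInstr.exec, act_update]; rfl) (ih _ _)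
  | peek k f q ih => exact Relation.TransGen.head rfl (ih _ _)
  | pop k f q ih =>
    exact Relation.TransGen.head
      (by simp only [step, ofTM2, Option.map_some, StackInstr.exec, act_update]; rfl) (ih _ _)
  | load f q ih => exact Relation.TransGen.head rfl (ih _ _)
  | branch f q₁ q₂ ih₁ ih₂ =>
    refine Relation.TransGen.head rfl ?_
    simp only [TM2.stepAux, StackInstr.exec]
    cases f v
    · exact ih₂ _ _
    · exact ih₁ _ _
  | goto f => exact Relation.TransGen.single rfl
  | halt => exact Relation.TransGen.single rfl

theorem eval_ofTM2_dom (M : Λ → TM2.Stmt (fun _ : K => Γ) Λ σ)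
    (c : TM2.Cfg (fun _ : K => Γ) Λ σ) :
    (StateTransition.eval (ofTM2 M).step (ofTM2Cfg M c)).Dom ↔
      (StateTransition.eval (TM2.step M) c).Dom := by
  refine StateTransition.tr_eval_dom (tr := fun c c' => ofTM2Cfg M c = c') ?_ rfl
  rintro ⟨_ | l, v, S⟩ _ rfl
  · rfl
  · exact ⟨_, rfl, reaches₁_stepAux M (M l) v S⟩

/-- The remaining statement is always a substatement of a supported label's body, and `goto` stays
within the support. -/
theorem next_mem_tm2States [Fintype σ] [Inhabited Λ] {M : Λ → TM2.Stmt (fun _ : K => Γ) Λ σ}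
    {S : Finset Λ} (hS : TM2.Supports M S) :
    ∀ q ∈ tm2States M S, ∀ i, ofTM2 M q = some i → ∀ o, i.next o ∈ tm2States M S := by
  have self {q : TM2.Stmt (fun _ : K => Γ) Λ σ} : q ∈ TM2.stmts₁ q := TM2.stmts₁_self
  rintro ⟨_ | q, v⟩ hq i hi o
  · simp [ofTM2] at hi
  rw [mem_tm2States] at hq
  cases q <;> obtain rfl := Option.some.inj hi <;> rw [mem_tm2States]
  case halt => simp [TM2.stmts]
  case goto f => exact some_apply_mem_stmts M (TM2.stmts_supportsStmt hS hq v)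
  case branch f q₁ q₂ =>
    refine TM2.stmts_trans ?_ hq
    cases f v <;> simp [TM2.stmts₁, self]
  all_goals exact TM2.stmts_trans (by simp [TM2.stmts₁, self]) hq

end StackMachine

-- The universal program and its input.

instance : Fintype PartrecToTM2.K' where
  elems := {.main, .rev, .aux, .stack}
  complete k := by cases k <;> simp

theorem trNat_two_pow (j : ℕ) :
    PartrecToTM2.trNat (2 ^ j) = List.replicate j .bit0 ++ [.bit1] := by
  have h (j : ℕ) : ∃ p : PosNum, ((2 ^ j : ℕ) : Num) = Num.pos p ∧
      PartrecToTM2.trPosNum p = List.replicate j .bit0 ++ [.bit1] := by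
    induction j with
    | zero => exact ⟨1, by simp; rfl, rfl⟩
    | succ j ih =>
      obtain ⟨p, hp, hw⟩ := ih
      refine ⟨p.bit0, ?_, by simp [PartrecToTM2.trPosNum, hw, List.replicate_succ]⟩
      rw [pow_succ, mul_two, Nat.cast_add, hp]
      exact (Num.bit0_of_bit0 (Num.pos p)).symm ▸ rfl
  obtain ⟨p, hp, hw⟩ := h j
  rw [PartrecToTM2.trNat, hp]
  exact hw

/-- Input `2 ^ j` in the stack alphabet. -/
def inputWord (j : ℕ) : List PartrecToTM2.Γ' := List.replicate j .bit0 ++ [.bit1, .cons]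

theorem init_stk (c : ToPartrec.Code) (j : ℕ) :
    PartrecToTM2.init c [2 ^ j] = ⟨some (PartrecToTM2.trNormal c .halt), none,
      Function.update (fun _ => []) .main (inputWord j)⟩ := by
  simp only [PartrecToTM2.init, PartrecToTM2.trList, trNat_two_pow, inputWord]
  congr 1
  funext k
  cases k <;> simp [Function.update]

/-- The formula that is satisfiable if and only if `c` diverges on input `2 ^ j`. -/
noncomputable def divergenceFormula {AP Sg : Type} (a : AP) (c : ToPartrec.Code) (j : ℕ) :
    LinearFormula AP Sg :=
  StackMachine.runFormula a (StackMachine.ofTM2 PartrecToTM2.tr)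
    (StackMachine.tm2States PartrecToTM2.tr (PartrecToTM2.codeSupp c .halt))
    (some (PartrecToTM2.tr (PartrecToTM2.trNormal c .halt)), none) .main (inputWord j)

theorem satisfiable_divergenceFormula {AP Sg : Type} [Nonempty Sg] (a : AP) (c : ToPartrec.Code)
    (j : ℕ) :
    (divergenceFormula a c j : LinearFormula AP Sg).Satisfiable ↔ ¬ (c.eval [2 ^ j]).Dom := by
  have hS := PartrecToTM2.tr_supports c .halt
  refine (StackMachine.satisfiable_runFormula a _ _
    -- `TM2.Supports` refers to the default label, which must be the start label of `c`.
    (@StackMachine.next_mem_tm2States _ _ _ _ _ _ _ ⟨PartrecToTM2.trNormal c .halt⟩ _ _ hS) _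
    (StackMachine.mem_tm2States.2 (StackMachine.some_apply_mem_stmts _ hS.1)) _ _).trans ?_
  have h1 := StackMachine.eval_ofTM2_dom PartrecToTM2.tr (PartrecToTM2.init c [2 ^ j])
  rw [PartrecToTM2.tr_eval] at h1
  rw [init_stk] at h1
  exact not_congr h1

open Nat.Partrec (Code)

/-- A universal program: search for the exponent `j` of the input, then run the `j`-th code on 0. -/
theorem exists_code_eval_two_pow_dom :
    ∃ c : ToPartrec.Code, ∀ j, (c.eval [2 ^ j]).Dom ↔ ((Denumerable.ofNat Code j).eval 0).Dom := by
  let f : ℕ →. ℕ := fun x =>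
    (Nat.rfind fun j => Part.some (decide (2 ^ j = x))).bind
      fun j => (Denumerable.ofNat Code j).eval 0
  have hp : Partrec f := by
    refine Partrec.bind (Partrec.rfind ?_) ?_
    · refine Computable₂.partrec₂ (f := fun x j : ℕ => decide (2 ^ j = x)) ?_
      have h2 : Primrec fun p : ℕ × ℕ => 2 ^ p.2 := by
        refine (Primrec.nat_rec' Primrec.snd (Primrec.const 1)
          ((Primrec.nat_mul.comp (Primrec.snd.comp Primrec.snd) (Primrec.const 2)).to₂)).of_eq ?_
        rintro ⟨x, j⟩
        induction j with
        | zero => rfl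
        | succ j ih => simpa [pow_succ] using ih
      exact ((Primrec.eq.comp h2 Primrec.fst).decide).to_comp
    · exact (Nat.Partrec.Code.eval_part.comp ((Computable.ofNat Code).comp Computable.snd)
        (Computable.const 0)).to₂
  obtain ⟨c, hc⟩ := ToPartrec.Code.exists_code (Nat.Partrec'.part_iff₁.2 hp)
  refine ⟨c, fun j => ?_⟩
  have h := hc (2 ^ j ::ᵥ List.Vector.nil)
  have hj : (Nat.rfind fun i => Part.some (decide (2 ^ i = 2 ^ j))) = Part.some j := by
    refine Part.eq_some_iff.2 (Nat.mem_rfind.2 ⟨by simp, fun {i} hi => ?_⟩)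
    simp [hi.ne]
  have h' : c.eval [2 ^ j] = pure <$> f (2 ^ j) := h
  rw [h']
  simp only [f, hj, Part.bind_some]
  rfl

-- Computability of the reduction.

variable {m k : ℕ}

/-- In prefix notation a further letter `b` just prepends a fixed word `u`, so the code is obtained
by iterating `u ++ ·`. -/
theorem computable_code_wordFormula {K Γ : Type} [Fintype K] [Fintype Γ] {n : ℕ} (a : Fin m)
    (l : Fin n) (x : K) (b : Γ) (w : List Γ) :
    Computable fun j : ℕ => (StackMachine.wordFormula a l x (List.replicate j b ++ w) :
      Formula (Fin m) (Fin k) n).code := by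
  have h : ∃ u : List ℕ, ∀ w : List Γ, (StackMachine.wordFormula a l x (b :: w) :
      Formula (Fin m) (Fin k) n).code =
        u ++ (StackMachine.wordFormula a l x w : Formula (Fin m) (Fin k) n).code := by
    refine ⟨2 :: ((Formula.later (StackMachine.cell x (some b) 0) (.atom a l) :
      Formula (Fin m) (Fin k) n).code ++
        4 :: (Program.skip (StackMachine.tracks K Γ) : Program (Fin m) (Fin k) n).code),
      fun w => ?_⟩
    simp [StackMachine.wordFormula, Formula.code, Formula.later]
  obtain ⟨u, hu⟩ := h
  refine (Primrec.nat_rec₁ (f := fun _ r => u ++ r)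
    (StackMachine.wordFormula a l x w : Formula (Fin m) (Fin k) n).code
    ((Primrec.list_append.comp (Primrec.const u) Primrec.snd).to₂)).to_comp.of_eq fun j => ?_
  induction j with
  | zero => rfl
  | succ j ih => simpa [List.replicate_succ, hu] using ih

theorem computable_code_divergenceFormula (a : Fin m) (c : ToPartrec.Code) :
    Computable fun j : ℕ =>
      PrenexFormula.code (divergenceFormula a c j : LinearFormula (Fin m) (Fin k)) := by
  simp only [divergenceFormula, StackMachine.runFormula, PrenexFormula.code, Formula.code,
    StackMachine.initFormula, inputWord]
  have hw := computable_code_wordFormula (k := k) a (0 : Fin 3) PartrecToTM2.K'.main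
    PartrecToTM2.Γ'.bit0 [.bit1, .cons]
  have happ {f g : ℕ → List ℕ} (hf : Computable f) (hg : Computable g) :
      Computable fun j => f j ++ g j := Primrec.list_append.to_comp.comp hf hg
  have hcons (x : ℕ) {f : ℕ → List ℕ} (hf : Computable f) : Computable fun j => x :: f j :=
    Primrec.list_cons.to_comp.comp (Computable.const x) hf
  exact hcons _ (hcons _ (hcons _ (hcons _
    (happ (hcons _ (happ hw (Computable.const _))) (Computable.const _)))))

end HyperPDL

theorem mainTheorem7 (m k : ℕ) (hm : 0 < m) (hk : 0 < k) :
    ¬ ∃ D : List ℕ → Prop, ComputablePred D ∧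
      ∀ φ : HyperPDL.LinearFormula (Fin m) (Fin k),
        D (HyperPDL.PrenexFormula.code φ) ↔ HyperPDL.LinearFormula.Satisfiable φ := by
  rintro ⟨D, hD, h⟩
  have : Nonempty (Fin k) := ⟨⟨0, hk⟩⟩
  obtain ⟨c, hc⟩ := HyperPDL.exists_code_eval_two_pow_dom
  -- Satisfiability means divergence, so halting reduces to the complement of `D`.
  refine ComputablePred.halting_problem 0 (ComputablePred.computable_of_manyOneReducible
    (q := fun w => ¬ D w) ⟨fun e => HyperPDL.PrenexFormula.code
      (HyperPDL.divergenceFormula ⟨0, hm⟩ c (Encodable.encode e) :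
        HyperPDL.LinearFormula (Fin m) (Fin k)),
      (HyperPDL.computable_code_divergenceFormula _ c).comp Computable.encode, fun e => ?_⟩ hD.not)
  change (e.eval 0).Dom ↔ ¬ D _
  rw [h, HyperPDL.satisfiable_divergenceFormula, hc]
  simp
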